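/- A real polynomial $f$ is called Hurwitz stable if it is identically zero or $f(z)\neq0$ for all $z\in\mathbb{C}$ with $\operatorname{Re} z>0$; a polynomial $f=\sum_{k=0}^{d}f_kx^k$ of degree $d$ is called symmetric if $f_k=f_{d-k}$ for $0\le k\le d$; and $f$ is called semi-$\gamma$-positive if there are $\varepsilon\in\{0,1\}$, $N\in\mathbb{N}$ and real numbers $g_0,\dots,g_N\ge0$ with $$f(x)=(1+x)^{\varepsilon}\sum_{k=0}^{N}g_kx^k(1+x^2)^{N-k}.$$ **Theorem.** Let $(\beta_n)_{n\ge0}$, $(\mu_n)_{n\ge0}$, $(\nu_n)_{n\ge0}$ be real sequences with $\mu_n\le0\le\nu_n$ for all $n$, and let $(T_n(x))_{n\ge0}$ be a sequence of real polynomials such that, with $m_n=\deg T_n$, one has $m_{n+1}=m_n+1$ and $$T_{n+1}(x)=\left(-m_n\mu_nx^2+\beta_nx+\beta_n+m_n\nu_n\right)T_n(x)+\left(\mu_nx^3+\nu_nx^2-\nu_nx-\mu_n\right)T_n'(x)$$ for all $n\ge0$. Assume that $\mu_n+\nu_n\le0$ and $2\beta_n+m_n(\mu_n+\nu_n)\ge0$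 for all $n\ge0$, and that $T_0$ is Hurwitz stable. Then $T_n$ is Hurwitz stable for every $n\ge0$. If moreover $T_0$ is symmetric and has positive leading coefficient, then $T_n$ is semi-$\gamma$-positive for every $n\ge0$. -/

import Mathlib

open Polynomial

/-- A real polynomial, viewed as a complex one, is Hurwitz stable if it is identically zero or
has no zero in the open right half-plane. -/
def IsHurwitzStable (f : ℝ[X]) : Prop :=
  f = 0 ∨ ∀ z : ℂ, 0 < z.re → aeval z f ≠ 0

/-- `f = ∑_{k=0}^d f_k x^k` of degree `d` is symmetric if `f_k = f_{d-k}` for `0 ≤ k ≤ d`. -/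
def IsSymmetricPoly (f : ℝ[X]) : Prop :=
  ∀ k ≤ f.natDegree, f.coeff k = f.coeff (f.natDegree - k)

/-- `f = (1+x)^ε ∑_{k=0}^N g_k x^k (1+x^2)^{N-k}` with `ε ∈ {0,1}` and all `g_k ≥ 0`. -/
def IsSemiGammaPositive (f : ℝ[X]) : Prop :=
  ∃ (ε N : ℕ) (g : ℕ → ℝ), (ε = 0 ∨ ε = 1) ∧ (∀ k ≤ N, 0 ≤ g k) ∧
    f = (1 + X) ^ ε * ∑ k ∈ Finset.range (N + 1), C (g k) * X ^ k * (1 + X ^ 2) ^ (N - k)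

/-!
Write `P = d f - x f'` for the second partial derivative of the degree-`d` homogenization of `f`.
With `a = (ν - μ) / 2`, `q = -(μ + ν) / 2` and `b = β + d (μ + ν) / 2`, the right-hand side of the
recurrence is `b (1 + x) f + q (1 + x) (f' + x P) + a (1 + x²) (f' + P)`. If `f` is Hurwitz stable,
then `H = (f' + x P) / f` maps the right half-plane to itself, because each root `r` contributes
`(1 - r x) / (x - r)`. Dividing by `(1 + x) (d f + f' + x P)` turns the three terms into nonnegative
multiples of functions with positive real part, so their sum can vanish only if `a = b = q = 0`.

The operator also sends palindromic polynomials of degree `d` to palindromic ones of degree `d + 1`.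
A palindromic polynomial of degree `2 N` is `x ^ N p(x + 1 / x)`, and `x ↦ x + 1 / x` maps the right
half-plane onto itself, so `p` inherits stability; hence its coefficients, which are the `g_k`, all
have the same sign.
-/

noncomputable section

section PolarDerivative

variable {R : Type*} [CommRing R]

/-- The polar derivative of `f` with respect to `0`: if `F(x, y) = y ^ d f(x / y)` is the
homogenization of `f` in degree `d`, this is `∂F/∂y` at `(x, 1)`. -/
def polarDerivative (d : ℕ) (f : R[X]) : R[X] :=
  C (d : R) * f - X * derivative f

/-- The right-hand side of the recurrence, with `d` a formal degree that may exceed the actual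
degree of `f`. -/
def recurrenceStep (d : ℕ) (β μ ν : R) (f : R[X]) : R[X] :=
  (C (-(d : R) * μ) * X ^ 2 + C β * X + C (β + (d : R) * ν)) * f
    + (C μ * X ^ 3 + C ν * X ^ 2 - C ν * X - C μ) * derivative f

lemma recurrenceStep_eq_polarDerivative (d : ℕ) (β μ ν : R) (f : R[X]) :
    recurrenceStep d β μ ν f = C β * ((1 + X) * f)
      + C (-μ) * (derivative f + X ^ 2 * polarDerivative d f)
      + C ν * (polarDerivative d f + X ^ 2 * derivative f) := by
  simp only [recurrenceStep, polarDerivative, C_neg, C_add, C_mul]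
  ring

lemma eval_one_recurrenceStep (d : ℕ) (β μ ν : R) (f : R[X]) :
    (recurrenceStep d β μ ν f).eval 1
      = ((2 * β + d * (μ + ν)) + 2 * (d * -μ)) * f.eval 1 := by
  simp only [recurrenceStep, eval_add, eval_sub, eval_mul, eval_pow, eval_C, eval_X]
  ring

lemma coeff_polarDerivative (d : ℕ) (f : R[X]) (k : ℕ) :
    (polarDerivative d f).coeff k = (d - k) * f.coeff k := by
  cases k with
  | zero => simp [polarDerivative]
  | succ k =>
    rw [polarDerivative, coeff_sub, coeff_C_mul, coeff_X_mul, coeff_derivative]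
    push_cast
    ring

lemma aeval_polarDerivative {A : Type*} [CommRing A] [Algebra R A] (d : ℕ) (f : R[X]) (z : A) :
    aeval z (polarDerivative d f) = d * aeval z f - z * aeval z (derivative f) := by
  simp [polarDerivative]

lemma reflect_derivative {d : ℕ} {f : R[X]} (hf : f.natDegree ≤ d) :
    reflect (d + 1) (derivative f) = X ^ 2 * polarDerivative d (reflect d f) := by
  have hzero {i : ℕ} (hi : d < i) : f.coeff i = 0 := coeff_eq_zero_of_natDegree_lt (hf.trans_lt hi)
  ext k
  rw [coeff_reflect, coeff_derivative, coeff_X_pow_mul']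
  split_ifs with hk
  · obtain ⟨k, rfl⟩ := Nat.exists_eq_add_of_le' hk
    rw [Nat.add_sub_cancel, coeff_polarDerivative, coeff_reflect]
    rcases lt_trichotomy k d with hkd | rfl | hkd
    · obtain ⟨j, rfl⟩ := Nat.exists_eq_add_of_lt hkd
      rw [revAt_le (by omega), revAt_le (by omega), show k + j + 1 + 1 - (k + 2) = j by omega,
        show k + j + 1 - k = j + 1 by omega]
      push_cast
      ring
    · rw [revAt_eq_self_of_lt (by omega), hzero (by omega)]
      simp
    · rw [revAt_eq_self_of_lt (by omega), revAt_eq_self_of_lt hkd, hzero (by omega), hzero hkd]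
      simp
  · rw [revAt_le (by omega), hzero (by omega), zero_mul]

lemma reflect_polarDerivative {d : ℕ} {f : R[X]} (hf : f.natDegree ≤ d) :
    reflect (d + 1) (polarDerivative d f) = X ^ 2 * derivative (reflect d f) := by
  have hzero {i : ℕ} (hi : d < i) : f.coeff i = 0 := coeff_eq_zero_of_natDegree_lt (hf.trans_lt hi)
  ext k
  rw [coeff_reflect, coeff_polarDerivative, coeff_X_pow_mul']
  split_ifs with hk
  · obtain ⟨k, rfl⟩ := Nat.exists_eq_add_of_le' hk
    rw [Nat.add_sub_cancel, coeff_derivative, coeff_reflect]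
    rcases lt_or_ge k d with hkd | hkd
    · obtain ⟨j, rfl⟩ := Nat.exists_eq_add_of_lt hkd
      rw [revAt_le (by omega), revAt_le (by omega), show k + j + 1 + 1 - (k + 2) = j by omega,
        show k + j + 1 - (k + 1) = j by omega]
      push_cast
      ring
    · rw [revAt_eq_self_of_lt (by omega), revAt_eq_self_of_lt (by omega), hzero (by omega),
        hzero (by omega), mul_zero, zero_mul]
  · rw [revAt_le (by omega)]
    obtain rfl | rfl : k = 0 ∨ k = 1 := by omega
    · rw [hzero (by omega), mul_zero]
    · simp

lemma natDegree_reflect_le_of_le {d : ℕ} {f : R[X]} (hf : f.natDegree ≤ d) :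
    (reflect d f).natDegree ≤ d :=
  natDegree_reflect_le.trans (max_le le_rfl hf)

lemma natDegree_derivative_le_of_le {d : ℕ} {f : R[X]} (hf : f.natDegree ≤ d) :
    (derivative f).natDegree ≤ d :=
  (natDegree_derivative_le f).trans ((Nat.sub_le _ _).trans hf)

lemma natDegree_polarDerivative_le {d : ℕ} {f : R[X]} (hf : f.natDegree ≤ d) :
    (polarDerivative d f).natDegree ≤ d := by
  refine natDegree_le_iff_coeff_eq_zero.2 fun k hk => ?_
  rw [coeff_polarDerivative, coeff_eq_zero_of_natDegree_lt (hf.trans_lt hk), mul_zero]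

lemma natDegree_recurrenceStep_le {d : ℕ} (β μ ν : R) {f : R[X]} (hf : f.natDegree ≤ d) :
    (recurrenceStep d β μ ν f).natDegree ≤ d + 1 := by
  have hrf := natDegree_reflect_le_of_le hf
  have h₀ : ((1 + X) * f).natDegree ≤ d + 1 := by
    rw [add_comm d 1]
    exact natDegree_mul_le_of_le (natDegree_add_le_of_degree_le (by simp) natDegree_X_le) hf
  have h₁ := natDegree_derivative_le_of_le hf
  have h₂ : (X ^ 2 * polarDerivative d f).natDegree ≤ d + 1 := by
    have h := reflect_derivative hrf
    rw [reflect_reflect] at h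
    rw [← h]
    exact natDegree_reflect_le_of_le ((natDegree_derivative_le_of_le hrf).trans d.le_succ)
  have h₃ := natDegree_polarDerivative_le hf
  have h₄ : (X ^ 2 * derivative f).natDegree ≤ d + 1 := by
    have h := reflect_polarDerivative hrf
    rw [reflect_reflect] at h
    rw [← h]
    exact natDegree_reflect_le_of_le ((natDegree_polarDerivative_le hrf).trans d.le_succ)
  rw [recurrenceStep_eq_polarDerivative]
  refine natDegree_add_le_of_degree_le (natDegree_add_le_of_degree_le
    ((natDegree_C_mul_le _ _).trans h₀) ((natDegree_C_mul_le _ _).trans ?_))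
    ((natDegree_C_mul_le _ _).trans ?_)
  · exact natDegree_add_le_of_degree_le (h₁.trans d.le_succ) h₂
  · exact natDegree_add_le_of_degree_le (h₃.trans d.le_succ) h₄

end PolarDerivative

section Palindromic

variable {R : Type*} [CommRing R] {m n N : ℕ} {p q : R[X]}

/-- `p` is palindromic of formal degree `N`, that is `p = ∑_{k=0}^N p_k x^k` with
`p_k = p_{N-k}`; the leading and trailing coefficients may vanish. The degree bound is needed
because `Polynomial.reflect N` fixes the coefficients above `N`. -/
structure IsPalindromic (N : ℕ) (p : R[X]) : Prop where
  natDegree_le : p.natDegree ≤ N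
  reflect_eq : reflect N p = p

lemma isPalindromic_add_reflect (hp : p.natDegree ≤ N) : IsPalindromic N (p + reflect N p) where
  natDegree_le := natDegree_add_le_of_degree_le hp (natDegree_reflect_le_of_le hp)
  reflect_eq := by rw [reflect_add, reflect_reflect, add_comm]

lemma isPalindromic_one_add_X : IsPalindromic 1 (1 + X : R[X]) := by
  simpa using isPalindromic_add_reflect (R := R) (p := 1) (N := 1) (by simp)

lemma isPalindromic_one_add_X_sq : IsPalindromic 2 (1 + X ^ 2 : R[X]) := by
  simpa using isPalindromic_add_reflect (R := R) (p := 1) (N := 2) (by simp)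

lemma isPalindromic_X : IsPalindromic 2 (X : R[X]) where
  natDegree_le := natDegree_X_le.trans one_le_two
  reflect_eq := by simpa [revAt_le] using reflect_monomial (R := R) 2 1

namespace IsPalindromic

lemma add (hp : IsPalindromic N p) (hq : IsPalindromic N q) : IsPalindromic N (p + q) where
  natDegree_le := natDegree_add_le_of_degree_le hp.natDegree_le hq.natDegree_le
  reflect_eq := by rw [reflect_add, hp.reflect_eq, hq.reflect_eq]

lemma C_mul (c : R) (hp : IsPalindromic N p) : IsPalindromic N (C c * p) where
  natDegree_le := (natDegree_C_mul_le c p).trans hp.natDegree_le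
  reflect_eq := by rw [reflect_C_mul, hp.reflect_eq]

lemma mul (hp : IsPalindromic m p) (hq : IsPalindromic n q) : IsPalindromic (m + n) (p * q) where
  natDegree_le := natDegree_mul_le_of_le hp.natDegree_le hq.natDegree_le
  reflect_eq := by
    rw [reflect_mul p q hp.natDegree_le hq.natDegree_le, hp.reflect_eq, hq.reflect_eq]

lemma pow (hp : IsPalindromic m p) (k : ℕ) : IsPalindromic (m * k) (p ^ k) := by
  induction k with
  | zero => exact ⟨by simp, by simp⟩
  | succ k ih => exact ih.mul hp

lemma of_mul_left (hp : IsPalindromic m p) (hmonic : p.Monic) (hq : q.natDegree ≤ n)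
    (hpq : IsPalindromic (m + n) (p * q)) : IsPalindromic n q where
  natDegree_le := hq
  reflect_eq := by
    apply hmonic.isRegular.left
    have h := hpq.reflect_eq
    rwa [reflect_mul p q hp.natDegree_le hq, hp.reflect_eq] at h

lemma coeff_zero (hp : IsPalindromic N p) : p.coeff 0 = p.coeff N := by
  conv_lhs => rw [← hp.reflect_eq, coeff_reflect, revAt_zero]

lemma eval_neg_one [IsAddTorsionFree R] (hp : IsPalindromic N p) (hN : Odd N) :
    p.eval (-1) = 0 := by
  let _ : Invertible (1 : R) := invertibleOne
  let _ : Invertible (-1 : R) := invertibleNeg 1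
  have h := eval₂_reflect_mul_pow (RingHom.id R) (-1) N p hp.natDegree_le
  rw [hp.reflect_eq, invOf_neg, invOf_one, hN.neg_one_pow, mul_neg_one, eval₂_id] at h
  exact self_eq_neg.1 h.symm

lemma exists_eq_one_add_X_mul [IsAddTorsionFree R] (hp : IsPalindromic (2 * N + 1) p) :
    ∃ q, p = (1 + X) * q ∧ IsPalindromic (2 * N) q := by
  have hroot : p.IsRoot (-1) := hp.eval_neg_one ⟨N, rfl⟩
  obtain ⟨q, rfl⟩ := dvd_iff_isRoot.2 hroot
  have hmonic : (1 + X : R[X]).Monic := by simpa [add_comm] using monic_X_add_C (1 : R)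
  have hX : (X - C (-1) : R[X]) = 1 + X := by rw [C_neg, C_1, sub_neg_eq_add, add_comm]
  rw [hX] at hp ⊢
  have hq : q.natDegree ≤ 2 * N := by
    nontriviality R
    rcases eq_or_ne q 0 with rfl | hq0
    · simp
    · have hdeg := hp.natDegree_le
      rw [hmonic.natDegree_mul' hq0, add_comm 1 X, ← C_1, natDegree_X_add_C] at hdeg
      omega
  exact ⟨q, rfl, isPalindromic_one_add_X.of_mul_left hmonic hq (by rwa [add_comm])⟩

protected lemma recurrenceStep {d : ℕ} (β μ ν : R) (hp : IsPalindromic d p) :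
    IsPalindromic (d + 1) (recurrenceStep d β μ ν p) := by
  have hd := (natDegree_derivative_le_of_le hp.natDegree_le).trans d.le_succ
  have hP := (natDegree_polarDerivative_le hp.natDegree_le).trans d.le_succ
  have h₁ := isPalindromic_add_reflect hd
  have h₂ := isPalindromic_add_reflect hP
  rw [reflect_derivative hp.natDegree_le, hp.reflect_eq] at h₁
  rw [reflect_polarDerivative hp.natDegree_le, hp.reflect_eq] at h₂
  rw [recurrenceStep_eq_polarDerivative]
  have h₀ : IsPalindromic (d + 1) ((1 + X) * p) := add_comm 1 d ▸ isPalindromic_one_add_X.mul hp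
  exact ((h₀.C_mul β).add (h₁.C_mul (-μ))).add (h₂.C_mul ν)

end IsPalindromic

lemma IsSymmetricPoly.isPalindromic {f : ℝ[X]} (hf : IsSymmetricPoly f) :
    IsPalindromic f.natDegree f where
  natDegree_le := le_rfl
  reflect_eq := by
    ext k
    rw [coeff_reflect]
    rcases le_or_gt k f.natDegree with hk | hk
    · rw [revAt_le hk, hf k hk]
    · rw [revAt_eq_self_of_lt hk]

end Palindromic

section GammaExpansion

variable {R : Type*} [CommRing R]

/-- The polynomial with γ-coefficients `g`, palindromic of formal degree `2 N`. -/
def gammaExpansion (N : ℕ) (g : ℕ → R) : R[X] :=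
  ∑ k ∈ Finset.range (N + 1), C (g k) * X ^ k * (1 + X ^ 2) ^ (N - k)

/-- The polynomial `p` with `gammaExpansion N g = x ^ N p(x + 1 / x)`; its coefficients are the
γ-coefficients in reverse order. -/
def gammaPolynomial (N : ℕ) (g : ℕ → R) : R[X] :=
  ∑ k ∈ Finset.range (N + 1), C (g k) * X ^ (N - k)

lemma coeff_gammaPolynomial {N k : ℕ} (g : ℕ → R) (hk : k ≤ N) :
    (gammaPolynomial N g).coeff (N - k) = g k := by
  rw [gammaPolynomial, finsetSum_coeff,
    Finset.sum_eq_single_of_mem k (Finset.mem_range_succ_iff.2 hk)]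
  · simp
  · intro j hj hjk
    have hjN := Finset.mem_range_succ_iff.1 hj
    rw [coeff_C_mul_X_pow, if_neg (by omega)]

lemma aeval_gammaExpansion {K : Type*} [Field K] [Algebra R K] (N : ℕ) (g : ℕ → R) {z : K}
    (hz : z ≠ 0) :
    aeval z (gammaExpansion N g) = z ^ N * aeval (z + z⁻¹) (gammaPolynomial N g) := by
  simp only [gammaExpansion, gammaPolynomial, map_sum, Finset.mul_sum]
  refine Finset.sum_congr rfl fun k hk => ?_
  have hkN : k + (N - k) = N := Nat.add_sub_of_le (Finset.mem_range_succ_iff.1 hk)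
  have hsq : 1 + z ^ 2 = z * (z + z⁻¹) := by field_simp; ring
  simp only [map_mul, map_pow, map_add, map_one, aeval_X, aeval_C]
  rw [hsq, mul_pow]
  conv_rhs => rw [← hkN, pow_add]
  simp only [Nat.add_sub_cancel_left]
  ring

lemma gammaExpansion_succ (N : ℕ) (g : ℕ → R) :
    gammaExpansion (N + 1) g
      = X * gammaExpansion N (fun k => g (k + 1)) + C (g 0) * (1 + X ^ 2) ^ (N + 1) := by
  rw [gammaExpansion, Finset.sum_range_succ', gammaExpansion, Finset.mul_sum]
  congr 1
  · refine Finset.sum_congr rfl fun k _ => ?_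
    rw [Nat.add_sub_add_right]
    ring
  · simp

lemma IsPalindromic.exists_eq_gammaExpansion {N : ℕ} {p : R[X]} (hp : IsPalindromic (2 * N) p) :
    ∃ g, p = gammaExpansion N g := by
  induction N generalizing p with
  | zero =>
    obtain ⟨c, rfl⟩ := natDegree_eq_zero.1 (Nat.le_zero.1 hp.natDegree_le)
    exact ⟨fun _ => c, by simp [gammaExpansion]⟩
  | succ N ih =>
    have hr : IsPalindromic (2 * (N + 1))
        (p + C (-p.coeff 0) * (1 + X ^ 2) ^ (N + 1)) :=
      hp.add ((isPalindromic_one_add_X_sq.pow (N + 1)).C_mul _)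
    have hr0 : (p + C (-p.coeff 0) * (1 + X ^ 2) ^ (N + 1)).coeff 0 = 0 := by
      simp [coeff_zero_eq_eval_zero]
    obtain ⟨q, hq⟩ := X_dvd_iff.2 hr0
    have hqdeg : q.natDegree ≤ 2 * N := by
      refine natDegree_le_iff_coeff_eq_zero.2 fun k hk => ?_
      rw [← coeff_X_mul, ← hq]
      obtain hk' | hk' : k + 1 = 2 * (N + 1) ∨ 2 * (N + 1) < k + 1 := by omega
      · rw [hk', ← hr.coeff_zero, hr0]
      · exact coeff_eq_zero_of_natDegree_lt (hr.natDegree_le.trans_lt hk')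
    have hqpal : IsPalindromic (2 * N) q := by
      refine isPalindromic_X.of_mul_left monic_X hqdeg ?_
      rw [← hq]
      convert hr using 1
      ring
    obtain ⟨g, hg⟩ := ih hqpal
    refine ⟨fun k => Nat.casesOn k (p.coeff 0) g, ?_⟩
    have hcons : gammaExpansion (N + 1) (fun k => Nat.casesOn k (p.coeff 0) g)
        = X * gammaExpansion N g + C (p.coeff 0) * (1 + X ^ 2) ^ (N + 1) :=
      gammaExpansion_succ N _
    rw [hcons, ← hg, ← hq, C_neg]
    ring

end GammaExpansion

section RightHalfPlane

lemma inv_re_pos {z : ℂ} (hz : 0 < z.re) : 0 < z⁻¹.re := by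
  rw [Complex.inv_re]
  exact div_pos hz (Complex.normSq_pos.2 (Complex.ne_zero_of_re_pos hz))

lemma re_div_ofReal_add_pos {w : ℂ} {c : ℝ} (hc : 0 ≤ c) (hw : 0 < w.re) :
    0 < (w / (c + w)).re := by
  have hw0 := Complex.ne_zero_of_re_pos hw
  have hinv : w / (c + w) = (1 + c * w⁻¹)⁻¹ := by
    rw [← inv_div, add_div, div_self hw0, div_eq_mul_inv, add_comm]
  rw [hinv]
  apply inv_re_pos
  rw [Complex.add_re, Complex.re_ofReal_mul, Complex.one_re]
  have := inv_re_pos hw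
  positivity

lemma re_one_add_sq_div_sq_pos {z : ℂ} (hz : 0 < z.re) :
    0 < ((1 + z ^ 2) / (1 + z) ^ 2).re := by
  have hz0 := Complex.ne_zero_of_re_pos hz
  have ht : 0 < (z + z⁻¹).re := by
    rw [Complex.add_re]
    exact add_pos hz (inv_re_pos hz)
  convert re_div_ofReal_add_pos zero_le_two ht using 2
  push_cast
  have h₁ : z * (z + z⁻¹) = 1 + z ^ 2 := by field_simp; ring
  have h₂ : z * (2 + (z + z⁻¹)) = (1 + z) ^ 2 := by field_simp; ring
  rw [← h₁, ← h₂, mul_div_mul_left _ _ hz0]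

lemma re_mobius_pos {z r : ℂ} (hz : 0 < z.re) (hr : r.re ≤ 0) :
    0 < ((1 - r * z) / (z - r)).re := by
  have hne : z - r ≠ 0 := Complex.ne_zero_of_re_pos (by rw [Complex.sub_re]; linarith)
  rw [Complex.div_re, ← add_div]
  refine div_pos ?_ (Complex.normSq_pos.2 hne)
  have hnum : (1 - r * z).re * (z - r).re + (1 - r * z).im * (z - r).im
      = z.re + (-r.re) + (r.re ^ 2 + r.im ^ 2) * z.re + (z.re ^ 2 + z.im ^ 2) * (-r.re) := by
    simp only [Complex.sub_re, Complex.sub_im, Complex.mul_re, Complex.mul_im, Complex.one_re,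
      Complex.one_im]
    ring
  rw [hnum]
  have hr' : 0 ≤ -r.re := neg_nonneg.2 hr
  positivity

lemma sum_map_mobius {K : Type*} [Field K] {z : K} {s : Multiset K} (hs : ∀ r ∈ s, z ≠ r) :
    (s.map fun r => (1 - r * z) / (z - r)).sum
      = s.card * z + (1 - z ^ 2) * (s.map fun r => 1 / (z - r)).sum := by
  have hterm : ∀ r ∈ s, (1 - r * z) / (z - r) = z + (1 - z ^ 2) * (1 / (z - r)) := fun r hr => by
    have := sub_ne_zero.2 (hs r hr)
    field_simp
    ring
  rw [Multiset.map_congr rfl hterm, Multiset.sum_map_add, Multiset.sum_map_mul_left,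
    Multiset.map_const', Multiset.sum_replicate, nsmul_eq_mul]

lemma multiset_sum_re_pos {s : Multiset ℂ} (hs : s ≠ ∅) (h : ∀ w ∈ s, 0 < w.re) :
    0 < s.sum.re :=
  Multiset.sum_induction_nonempty (fun w : ℂ => 0 < w.re)
    (fun _ _ ha hb => by rw [Complex.add_re]; exact add_pos ha hb) hs h

lemma exists_re_pos_add_inv_eq {y : ℂ} (hy : 0 < y.re) :
    ∃ z : ℂ, 0 < z.re ∧ z + z⁻¹ = y := by
  obtain ⟨w, hw⟩ := IsAlgClosed.exists_pow_nat_eq (y ^ 2 - 4) two_pos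
  have hquad : (y + w) / 2 * (y - (y + w) / 2) = 1 := by linear_combination -hw / 4
  have hinv : (y + w) / 2 + ((y + w) / 2)⁻¹ = y := by
    rw [inv_eq_of_mul_eq_one_right hquad]
    ring
  refine ⟨(y + w) / 2, ?_, hinv⟩
  by_contra! hneg
  rw [← hinv, Complex.add_re, Complex.inv_re] at hy
  linarith [div_nonpos_of_nonpos_of_nonneg hneg (Complex.normSq_nonneg ((y + w) / 2))]

lemma coeffs_eq_zero_of_re_pos {a b c : ℝ} {u v w : ℂ} (ha : 0 ≤ a) (hb : 0 ≤ b) (hc : 0 ≤ c)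
    (hu : 0 < u.re) (hv : 0 < v.re) (hw : 0 < w.re) (h : a * u + b * v + c * w = 0) :
    a = 0 ∧ b = 0 ∧ c = 0 := by
  have hre := congrArg Complex.re h
  simp only [Complex.add_re, Complex.re_ofReal_mul, Complex.zero_re] at hre
  have hau := mul_nonneg ha hu.le
  have hbv := mul_nonneg hb hv.le
  have hcw := mul_nonneg hc hw.le
  exact ⟨(mul_eq_zero.1 (by linarith : a * u.re = 0)).resolve_right hu.ne',
    (mul_eq_zero.1 (by linarith : b * v.re = 0)).resolve_right hv.ne',
    (mul_eq_zero.1 (by linarith : c * w.re = 0)).resolve_right hw.ne'⟩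

end RightHalfPlane

section Stability

namespace IsHurwitzStable

variable {f g : ℝ[X]}

lemma aeval_ne_zero (hf : IsHurwitzStable f) (h0 : f ≠ 0) {z : ℂ} (hz : 0 < z.re) :
    aeval z f ≠ 0 :=
  hf.resolve_left h0 z hz

lemma re_le_zero_of_aeval_eq_zero (hf : IsHurwitzStable f) (h0 : f ≠ 0) {z : ℂ}
    (hz : aeval z f = 0) : z.re ≤ 0 :=
  not_lt.1 fun hre => hf.aeval_ne_zero h0 hre hz

lemma neg (hf : IsHurwitzStable f) : IsHurwitzStable (-f) := by
  simpa [IsHurwitzStable] using hf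

lemma of_dvd (hf : IsHurwitzStable f) (h0 : f ≠ 0) (hgf : g ∣ f) : IsHurwitzStable g :=
  Or.inr fun _ hz hg => hf.aeval_ne_zero h0 hz (aeval_eq_zero_of_dvd_aeval_eq_zero hgf hg)

lemma re_polarDerivative_div_pos {d : ℕ} (hf : IsHurwitzStable f) (h0 : f ≠ 0)
    (hd : f.natDegree ≤ d) (hd0 : d ≠ 0) {z : ℂ} (hz : 0 < z.re) :
    0 < ((aeval z (derivative f) + z * aeval z (polarDerivative d f)) / aeval z f).re := by
  set s := (f.map (algebraMap ℝ ℂ)).roots with hs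
  have hsplits := IsAlgClosed.splits (f.map (algebraMap ℝ ℂ))
  have hfz := hf.aeval_ne_zero h0 hz
  have hcard : s.card = f.natDegree := by
    rw [hs, ← hsplits.natDegree_eq_card_roots, natDegree_map]
  have hroots : ∀ r ∈ s, r.re ≤ 0 := fun r hr =>
    hf.re_le_zero_of_aeval_eq_zero h0 (by simpa using! (mem_roots'.1 hr).2)
  have hlog : aeval z (derivative f) / aeval z f = (s.map fun r => 1 / (z - r)).sum := by
    have h := hsplits.eval_derivative_div_eval_of_ne_zero (x := z) (by simpa using hfz)
    simpa [derivative_map] using h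
  -- The `d - deg f` missing roots sit at infinity, where `(1 - r z) / (z - r)` tends to `z`.
  set t := s.map (fun r => (1 - r * z) / (z - r)) + Multiset.replicate (d - f.natDegree) z with ht
  have hsum : (aeval z (derivative f) + z * aeval z (polarDerivative d f)) / aeval z f = t.sum := by
    have hne : ∀ r ∈ s, z ≠ r := fun r hr h => ((hroots r hr).trans_lt hz).ne (congrArg _ h.symm)
    rw [ht, Multiset.sum_add, Multiset.sum_replicate, nsmul_eq_mul, sum_map_mobius hne, hcard,
      ← hlog, aeval_polarDerivative, Nat.cast_sub hd]
    field_simp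
    ring
  have ht0 : t ≠ ∅ := by
    rw [Multiset.empty_eq_zero, ← Multiset.card_pos, ht, Multiset.card_add, Multiset.card_map,
      Multiset.card_replicate, hcard]
    omega
  rw [hsum]
  refine multiset_sum_re_pos ht0 fun w hw => ?_
  rcases Multiset.mem_add.1 hw with hw | hw
  · obtain ⟨r, hr, rfl⟩ := Multiset.mem_map.1 hw
    exact re_mobius_pos hz (hroots r hr)
  · rwa [Multiset.eq_of_mem_replicate hw]

end IsHurwitzStable

lemma recurrenceStep_eq_combination (d : ℕ) (β μ ν : ℝ) (f : ℝ[X]) :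
    recurrenceStep d β μ ν f =
      C (β + d * (μ + ν) / 2) * ((1 + X) * f)
      + C (-(μ + ν) / 2) * ((1 + X) * (derivative f + X * polarDerivative d f))
      + C ((ν - μ) / 2) * ((1 + X ^ 2) * (derivative f + polarDerivative d f)) := by
  have hhalf (c : ℝ) : (C c : ℝ[X]) = 2 * C (c / 2) := by
    rw [← C_ofNat, ← C_mul, mul_div_cancel₀ c two_ne_zero]
  rw [recurrenceStep_eq_polarDerivative, polarDerivative]
  simp only [neg_div, add_div, sub_div, mul_add, mul_div_assoc, C_neg, C_add, C_sub, C_mul]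
  rw [hhalf μ, hhalf ν]
  ring

lemma isHurwitzStable_recurrenceStep_zero (β μ ν : ℝ) {f : ℝ[X]} (hf : f.natDegree ≤ 0) :
    IsHurwitzStable (recurrenceStep 0 β μ ν f) := by
  obtain ⟨c, rfl⟩ := natDegree_eq_zero.1 (Nat.le_zero.1 hf)
  have hstep : recurrenceStep 0 β μ ν (C c) = C (β * c) * (1 + X) := by
    simp only [recurrenceStep, derivative_C, mul_zero, add_zero, zero_mul, Nat.cast_zero, neg_zero,
      C_0, zero_add, C_mul]
    ring
  rw [hstep]
  rcases eq_or_ne (β * c) 0 with h | h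
  · exact Or.inl (by rw [h, C_0, zero_mul])
  · refine Or.inr fun z hz => ?_
    have hz1 : 1 + z ≠ 0 := Complex.ne_zero_of_re_pos (by simp; linarith)
    simpa [hz1] using h

lemma combination_coeffs_eq_zero {a b d q : ℝ} {z w u v : ℂ} (hd : 0 ≤ d) (hb : 0 ≤ b)
    (hq : 0 ≤ q) (ha : 0 ≤ a) (hz : 0 < z.re) (hw : w ≠ 0) (hv : v = d * w - z * u)
    (hH : 0 < ((u + z * v) / w).re)
    (h : b * ((1 + z) * w) + q * ((1 + z) * (u + z * v)) + a * ((1 + z ^ 2) * (u + v)) = 0) :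
    b = 0 ∧ q = 0 ∧ a = 0 := by
  set H := (u + z * v) / w with hHdef
  have hz1 : 1 + z ≠ 0 := Complex.ne_zero_of_re_pos (by simp; linarith)
  have hdH : 0 < (d + H).re := by
    rw [Complex.add_re, Complex.ofReal_re]
    positivity
  have hdH_eq : d + H = (1 + z) * (u + v) / w := by
    rw [hHdef]
    field_simp
    linear_combination -hv
  have huv : u + v ≠ 0 := by
    intro huv
    rw [hdH_eq, huv, mul_zero, zero_div, Complex.zero_re] at hdH
    exact hdH.false
  have hsum : b * (d + H)⁻¹ + q * (H / (d + H)) + a * ((1 + z ^ 2) / (1 + z) ^ 2) = 0 := by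
    rw [hdH_eq, hHdef]
    field_simp
    linear_combination h
  exact coeffs_eq_zero_of_re_pos hb hq ha (inv_re_pos hdH) (re_div_ofReal_add_pos hd hH)
    (re_one_add_sq_div_sq_pos hz) hsum

theorem isHurwitzStable_recurrenceStep {d : ℕ} {β μ ν : ℝ} {f : ℝ[X]} (hf : IsHurwitzStable f)
    (hd : f.natDegree ≤ d) (hle : μ ≤ ν) (hμν : μ + ν ≤ 0) (hβ : 0 ≤ 2 * β + d * (μ + ν)) :
    IsHurwitzStable (recurrenceStep d β μ ν f) := by
  rcases eq_or_ne d 0 with rfl | hd0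
  · exact isHurwitzStable_recurrenceStep_zero β μ ν hd
  rcases eq_or_ne f 0 with rfl | hf0
  · exact Or.inl (by simp [recurrenceStep])
  refine or_iff_not_imp_left.2 fun hne z hz hroot => hne ?_
  have hb : 0 ≤ β + d * (μ + ν) / 2 := by linarith
  have hq : 0 ≤ -(μ + ν) / 2 := by linarith
  have ha : 0 ≤ (ν - μ) / 2 := by linarith
  rw [recurrenceStep_eq_combination] at hroot ⊢
  generalize β + d * (μ + ν) / 2 = b at hb hroot ⊢
  generalize -(μ + ν) / 2 = q at hq hroot ⊢
  generalize (ν - μ) / 2 = a at ha hroot ⊢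
  simp only [map_add, map_mul, map_one, map_pow, aeval_C, aeval_X, Complex.coe_algebraMap]
    at hroot
  obtain ⟨rfl, rfl, rfl⟩ := combination_coeffs_eq_zero d.cast_nonneg hb hq ha hz
    (hf.aeval_ne_zero hf0 hz) (by rw [aeval_polarDerivative, Complex.ofReal_natCast])
    (hf.re_polarDerivative_div_pos hf0 hd hd0 hz) hroot
  simp only [C_0, zero_mul, add_zero]

end Stability

section Coefficients

lemma coeff_minpoly_nonneg_of_re_nonpos {z : ℂ} (hz : z.re ≤ 0) (k : ℕ) :
    0 ≤ (minpoly ℝ z).coeff k := by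
  by_cases him : z.im = 0
  · have hzre : z = algebraMap ℝ ℂ z.re := Complex.ext (by simp) (by simp [him])
    rw [hzre, minpoly.eq_X_sub_C, coeff_sub, coeff_X, coeff_C]
    split_ifs <;> linarith
  · have hint := Algebra.IsIntegral.isIntegral (R := ℝ) z
    have hquad : (X ^ 2 - C (2 * z.re) * X + C (‖z‖ ^ 2) : ℝ[X])
        = C 1 * X ^ 2 + C (-(2 * z.re)) * X + C (‖z‖ ^ 2) := by
      simp only [C_neg, C_1]
      ring
    have hdvd := (minpoly ℝ z).quadratic_dvd_of_aeval_eq_zero_im_ne_zero (minpoly.aeval ℝ z) him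
    rw [hquad] at hdvd
    have hmin := eq_of_monic_of_dvd_of_natDegree_le (leadingCoeff_quadratic one_ne_zero)
      (minpoly.monic hint) hdvd
      ((minpoly.irreducible hint).natDegree_le_two.trans_eq
        (natDegree_quadratic one_ne_zero).symm)
    have hre : 0 ≤ -(2 * z.re) := by linarith
    rw [hmin]
    simp only [coeff_add, coeff_C_mul, coeff_X_pow, coeff_X, coeff_C]
    positivity

lemma coeff_multiset_prod_nonneg {R : Type*} [CommSemiring R] [PartialOrder R] [IsOrderedRing R]
    {s : Multiset R[X]} (hs : ∀ p ∈ s, ∀ k, 0 ≤ p.coeff k) (k : ℕ) : 0 ≤ s.prod.coeff k := by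
  refine Multiset.prod_induction (fun p : R[X] => ∀ k, 0 ≤ p.coeff k) s (fun p q hp hq k => ?_)
    (fun k => ?_) hs k
  · rw [coeff_mul]
    exact Finset.sum_nonneg fun _ _ => mul_nonneg (hp _) (hq _)
  · rw [coeff_one]
    split_ifs
    exacts [zero_le_one, le_rfl]

namespace IsHurwitzStable

variable {f : ℝ[X]}

lemma coeff_nonneg_of_leadingCoeff_nonneg (hf : IsHurwitzStable f) (hlead : 0 ≤ f.leadingCoeff)
    (k : ℕ) : 0 ≤ f.coeff k := by
  classical
  rcases eq_or_ne f 0 with rfl | h0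
  · rw [coeff_zero]
  rw [← leadingCoeff_mul_prod_normalizedFactors f, coeff_C_mul]
  refine mul_nonneg hlead (coeff_multiset_prod_nonneg (fun p hp => ?_) k)
  obtain ⟨hirr, hmonic, hdvd⟩ := (Polynomial.mem_normalizedFactors_iff h0).1 hp
  obtain ⟨z, hz⟩ := IsAlgClosed.exists_aeval_eq_zero ℂ p hirr.degree_pos.ne'
  rw [minpoly.eq_of_irreducible_of_monic hirr hz hmonic]
  exact coeff_minpoly_nonneg_of_re_nonpos
    ((hf.of_dvd h0 hdvd).re_le_zero_of_aeval_eq_zero hirr.ne_zero hz)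

lemma eval_pos (hf : IsHurwitzStable f) (hlead : 0 < f.leadingCoeff) {x : ℝ} (hx : 0 < x) :
    0 < f.eval x := by
  rw [eval_eq_sum_range]
  exact Finset.sum_pos'
    (fun i _ => mul_nonneg (hf.coeff_nonneg_of_leadingCoeff_nonneg hlead.le i) (pow_pos hx i).le)
    ⟨f.natDegree, Finset.self_mem_range_succ _, mul_pos hlead (pow_pos hx _)⟩

lemma coeff_nonneg_of_eval_nonneg (hf : IsHurwitzStable f) {x : ℝ} (hx : 0 < x)
    (hfx : 0 ≤ f.eval x) (k : ℕ) : 0 ≤ f.coeff k := by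
  refine hf.coeff_nonneg_of_leadingCoeff_nonneg (not_lt.1 fun hlead => ?_) k
  have := hf.neg.eval_pos (by rwa [leadingCoeff_neg, neg_pos]) hx
  rw [eval_neg] at this
  linarith

end IsHurwitzStable

end Coefficients

section SemiGammaPositivity

lemma isHurwitzStable_gammaPolynomial {N : ℕ} {g : ℕ → ℝ}
    (hst : IsHurwitzStable (gammaExpansion N g)) (h0 : gammaExpansion N g ≠ 0) :
    IsHurwitzStable (gammaPolynomial N g) := by
  refine Or.inr fun y hy hroot => ?_
  obtain ⟨z, hz, rfl⟩ := exists_re_pos_add_inv_eq hy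
  refine hst.aeval_ne_zero h0 hz ?_
  rw [aeval_gammaExpansion N g (Complex.ne_zero_of_re_pos hz), hroot, mul_zero]

lemma gamma_nonneg_of_isHurwitzStable {N : ℕ} {g : ℕ → ℝ}
    (hst : IsHurwitzStable (gammaExpansion N g)) (h0 : gammaExpansion N g ≠ 0)
    (h1 : 0 ≤ (gammaExpansion N g).eval 1) {k : ℕ} (hk : k ≤ N) : 0 ≤ g k := by
  have heval : (gammaExpansion N g).eval 1 = (gammaPolynomial N g).eval (1 + 1⁻¹) := by
    simpa using aeval_gammaExpansion N g (one_ne_zero (α := ℝ))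
  rw [← coeff_gammaPolynomial g hk]
  exact (isHurwitzStable_gammaPolynomial hst h0).coeff_nonneg_of_eval_nonneg (x := 1 + 1⁻¹)
    (by norm_num) (heval ▸ h1) _

theorem IsPalindromic.isSemiGammaPositive {d : ℕ} {f : ℝ[X]} (hf : IsPalindromic d f)
    (hst : IsHurwitzStable f) (h1 : 0 ≤ f.eval 1) : IsSemiGammaPositive f := by
  rcases eq_or_ne f 0 with rfl | h0
  · exact ⟨0, 0, 0, Or.inl rfl, by simp, by simp⟩
  obtain ⟨N, rfl | rfl⟩ := Nat.even_or_odd' d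
  · obtain ⟨g, rfl⟩ := hf.exists_eq_gammaExpansion
    exact ⟨0, N, g, Or.inl rfl, fun _ => gamma_nonneg_of_isHurwitzStable hst h0 h1,
      by rw [pow_zero, one_mul, gammaExpansion]⟩
  · obtain ⟨q, rfl, hq⟩ := hf.exists_eq_one_add_X_mul
    obtain ⟨g, rfl⟩ := hq.exists_eq_gammaExpansion
    have hq1 : 0 ≤ (gammaExpansion N g).eval 1 := by
      rw [eval_mul, eval_add, eval_one, eval_X] at h1
      linarith
    exact ⟨1, N, g, Or.inr rfl,
      fun _ => gamma_nonneg_of_isHurwitzStable (hst.of_dvd h0 (dvd_mul_left _ _))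
        (right_ne_zero_of_mul h0) hq1,
      by rw [pow_one, gammaExpansion]⟩

end SemiGammaPositivity

end

theorem mainTheorem6_general
    (β μ ν : ℕ → ℝ) (m : ℕ → ℕ) (T : ℕ → ℝ[X])
    (hdeg : (T 0).natDegree ≤ m 0)
    (hgrow : ∀ n, m (n + 1) = m n + 1)
    (hrec : ∀ n, T (n + 1) = recurrenceStep (m n) (β n) (μ n) (ν n) (T n))
    (hle : ∀ n, μ n ≤ ν n)
    (hμν : ∀ n, μ n + ν n ≤ 0)
    (hβ : ∀ n, 0 ≤ 2 * β n + (m n : ℝ) * (μ n + ν n))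
    (hT0 : IsHurwitzStable (T 0)) :
    (∀ n, IsHurwitzStable (T n)) ∧
      (IsPalindromic (m 0) (T 0) → 0 ≤ (T 0).eval 1 → ∀ n, IsSemiGammaPositive (T n)) := by
  have hdegree : ∀ n, (T n).natDegree ≤ m n := by
    intro n
    induction n with
    | zero => exact hdeg
    | succ n ih => rw [hrec, hgrow]; exact natDegree_recurrenceStep_le _ _ _ ih
  have hstable : ∀ n, IsHurwitzStable (T n) := by
    intro n
    induction n with
    | zero => exact hT0
    | succ n ih =>
      rw [hrec]
      exact isHurwitzStable_recurrenceStep ih (hdegree n) (hle n) (hμν n) (hβ n)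
  refine ⟨hstable, fun hpal hone n => ?_⟩
  suffices h : IsPalindromic (m n) (T n) ∧ 0 ≤ (T n).eval 1 from
    h.1.isSemiGammaPositive (hstable n) h.2
  induction n with
  | zero => exact ⟨hpal, hone⟩
  | succ n ih =>
    rw [hrec, hgrow, eval_one_recurrenceStep]
    have hμ : 0 ≤ -μ n := by linarith [hle n, hμν n]
    have := hβ n
    exact ⟨ih.1.recurrenceStep _ _ _, mul_nonneg (by positivity) ih.2⟩

theorem mainTheorem6
    (β μ ν : ℕ → ℝ) (m : ℕ → ℕ) (T : ℕ → ℝ[X])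
    (hdeg : ∀ n, (T n).natDegree = m n)
    (hgrow : ∀ n, m (n + 1) = m n + 1)
    (hrec : ∀ n, T (n + 1) =
      (C (-(m n : ℝ) * μ n) * X ^ 2 + C (β n) * X + C (β n + (m n : ℝ) * ν n)) * T n
        + (C (μ n) * X ^ 3 + C (ν n) * X ^ 2 - C (ν n) * X - C (μ n)) * derivative (T n))
    (hμ : ∀ n, μ n ≤ 0) (hν : ∀ n, 0 ≤ ν n)
    (hμν : ∀ n, μ n + ν n ≤ 0)
    (hβ : ∀ n, 0 ≤ 2 * β n + (m n : ℝ) * (μ n + ν n))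
    (hT0 : IsHurwitzStable (T 0)) :
    (∀ n, IsHurwitzStable (T n)) ∧
      (IsSymmetricPoly (T 0) → 0 < (T 0).leadingCoeff → ∀ n, IsSemiGammaPositive (T n)) := by
  obtain ⟨hstable, hgamma⟩ := mainTheorem6_general β μ ν m T (hdeg 0).le hgrow hrec
    (fun n => (hμ n).trans (hν n)) hμν hβ hT0
  exact ⟨hstable, fun hsym hlead =>
    hgamma (hdeg 0 ▸ hsym.isPalindromic) (hT0.eval_pos hlead one_pos).le⟩
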